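/- Let $S$ be a compact connected oriented surface, possibly with boundary, and let $\mathfrak P(S)$ be the space of isotopy classes of convex projective structures on $S$ (with straight boundary). A structure $\pi$ has a developing map $\mathrm{dev}_\pi\colon\widetilde S\to\mathbb{RP}^2$ and a monodromy $\rho_\pi\colon\pi_1(S)\to\mathrm{SL}_3(\mathbb R)$. Let $C$ be a pair of pants decomposition of $S$, that is, a finite family of disjoint simple closed curves in the interior of $S$ whose complementary components are pairs of pants, and orient each component $C_i$ of $C$. The matrix $\rho_\pi(C_i)$ has eigenvalues $0<\lambda_i<\mu_i<\nu_i$. For $u\in\mathbb R$, the twist deformation $T^u_{C_i}\colon\mathfrak P(S)\to\mathfrak P(S)$ modifies $\pi$ on the right-hand side of $C_i$ by composing its charts with the projective map whose matrix, in a basis of eigenvectors of $\rho_\pi(C_i)$ for $\lambda_i,\mu_i,\nu_i$ (in this order), is $\mathrm{diag}(e^{-u},1,e^{u})$; the construction is performed $\rho_\pi$-equivariantly in the universal cover, along all lifts of $C_i$ (and, near $C_i$, up to isotopy). For $v\in\mathbb R$, the bulge deformation $B^v_{C_i}$ is defined in the same way from $\mathrm{diag}(e^{-v},e^{2v},e^{-v})$.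 Let $\Lambda$ be the union of $C\cup\partial S$ and, in each pair of pants, of three disjoint simple lines joining its three pairs of distinct ends, each spiraling at both ends along the boundary of the pair of pants in the direction of the boundary orientation. Fix a lift $\widetilde C_i$ of $C_i$ to $\widetilde S$, invariant under $C_i\in\pi_1(S)$, and two leaves $\widetilde B^{\mathrm{left}}$, $\widetilde B^{\mathrm{right}}$ of the preimage of $\Lambda$, lifting spiraling leaves, such that $\widetilde B^{\mathrm{left}}$ is on the left of $\widetilde C_i$ and asymptotic to its positive endpoint, and $\widetilde B^{\mathrm{right}}$ is on the right of $\widetilde C_i$ and asymptotic to its negative endpoint. To each endpoint of these leaves associate the unstable flag of $\rho_\pi(A)$, where $A\in\pi_1(S)$ represents the boundary curve of the pair of pants at this endpoint, oriented opposite to the boundary orientation (the line of the unstable flag is the eigenspace of the lowest eigenvalue, and its plane is the sum of the eigenspaces of the two lowest eigenvalues). Let $E,F,G,H$ be the flags associated with the positive endpoint of $\widetilde C_i$, the negative endpoint of $\widetilde C_i$, the other endpoint of $\widetilde B^{\mathrm{left}}$ and the other endpoint of $\widetilde B^{\mathrm{right}}$, respectively. For arbitrary nonzero $e^{(a)}\in\Lambda^a(E^{(a)})$,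 $f^{(a)}\in\Lambda^a(F^{(a)})$, $g^{(1)}\in G^{(1)}$, $h^{(1)}\in H^{(1)}$, the shear invariants of $\pi$ along $C_i$ are $$\sigma_1(C_i)=\log\left(-\frac{e^{(1)}\wedge f^{(1)}\wedge g^{(1)}}{e^{(1)}\wedge f^{(1)}\wedge h^{(1)}}\,\frac{f^{(2)}\wedge h^{(1)}}{f^{(2)}\wedge g^{(1)}}\right),\qquad \sigma_2(C_i)=\log\left(-\frac{e^{(1)}\wedge f^{(1)}\wedge h^{(1)}}{e^{(1)}\wedge f^{(1)}\wedge g^{(1)}}\,\frac{e^{(2)}\wedge g^{(1)}}{e^{(2)}\wedge h^{(1)}}\right),$$ where the quantities inside the logarithms are positive. **Lemma.** If the shear invariants of $\pi\in\mathfrak P(S)$ along $C_i$ are $\sigma_1(C_i)$ and $\sigma_2(C_i)$, then, for all $u,v\in\mathbb R$, the class $T^u_{C_i}(\pi)\in\mathfrak P(S)$ has shear invariants exactly $\sigma_1(C_i)+u$ and $\sigma_2(C_i)+u$, and the class $B^v_{C_i}(\pi)\in\mathfrak P(S)$ has shear invariants exactly $\sigma_1(C_i)-3v$ and $\sigma_2(C_i)+3v$,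 for the same choice of $\widetilde C_i$, $\widetilde B^{\mathrm{left}}$, $\widetilde B^{\mathrm{right}}$. -/

import Mathlib

open Topology Filter
open scoped Manifold Matrix LinearAlgebra.Projectivization

namespace ConvexProjective

/-! ### The real projective plane -/

/-- The real projective plane. -/
abbrev RP2 : Type := ℙ ℝ (Fin 3 → ℝ)

/-- The quotient topology on the projective plane. -/
instance RP2.instTopologicalSpace : TopologicalSpace RP2 :=
  inferInstanceAs (TopologicalSpace (Quotient (projectivizationSetoid ℝ (Fin 3 → ℝ))))

/-- The group `SL₃(ℝ) = PGL₃(ℝ)` of projective transformations, acting on `RP2` through Mathlib's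
action of the special linear group on projective space. -/
abbrev SL3 : Type := Matrix.SpecialLinearGroup (Fin 3) ℝ

/-- A subset of the projective plane is convex if it is disjoint from some projective line
`m = 0`, and convex in the affine plane `m = 1` complementary to this line. -/
def IsConvexInRP2 (Ω : Set RP2) : Prop :=
  ∃ m : (Fin 3 → ℝ) →ₗ[ℝ] ℝ, (∀ q ∈ Ω, m q.rep ≠ 0) ∧
    Convex ℝ {v : Fin 3 → ℝ | m v = 1 ∧ ∃ hv : v ≠ 0, Projectivization.mk ℝ v hv ∈ Ω}

/-! ### Orientations of topological surfaces -/

/-- A map `f` between planes, injective near `z`, preserves the orientation at `z`: on small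
circles around `z`, the direction from `f z` to the image point turns once in the
positive direction when the circle is traversed once in the positive direction. -/
def PreservesOrientationAt (f : ℂ → ℂ) (z : ℂ) : Prop :=
  ∀ᶠ r : ℝ in 𝓝[>] 0, ∃ θ : ℝ → ℝ, Continuous θ ∧
    (∀ t, θ (t + 2 * Real.pi) = θ t + 2 * Real.pi) ∧
    ∀ t : ℝ, f (z + r * Complex.exp (t * Complex.I)) - f z =
      ‖f (z + r * Complex.exp (t * Complex.I)) - f z‖ * Complex.exp (θ t * Complex.I)

section Surface

variable {S : Type*} [TopologicalSpace S]

/-- The local parametrization `φ` of a surface, restricted to the region `D` of the plane, and the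
parametrization `ψ` define the same orientation where they overlap. -/
def SameOrientationOn (D : Set ℂ) (φ ψ : ℂ → S) : Prop :=
  ∀ z ∈ D, ∀ w, ψ w = φ z →
    ∃ f : ℂ → ℂ, f z = w ∧ (∀ᶠ y in 𝓝 z, ψ (f y) = φ y) ∧ PreservesOrientationAt f z

variable (S) in
/-- An orientation of a topological surface `S`, given by an oriented atlas of its interior. -/
structure SurfaceOrientation [ChartedSpace (EuclideanHalfSpace 2) S] where
  /-- The positively oriented parametrizations, defined on the whole plane. -/
  charts : Set (ℂ → S)
  isOpenEmbedding : ∀ ψ ∈ charts, IsOpenEmbedding ψ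
  cover : ∀ x ∈ (𝓡∂ 2).interior S, ∃ ψ ∈ charts, x ∈ Set.range ψ
  compatible : ∀ φ ∈ charts, ∀ ψ ∈ charts, SameOrientationOn Set.univ φ ψ

/-! ### Projective structures -/

variable (S) in
/-- A chart with values in the projective plane: an embedding of an open subset of `S`, whose image
is open near the image of an interior point of `S`, and is one side of a
straight line `ℓ = 0` near the image of a boundary point of `S`. -/
structure ProjectiveChart [ChartedSpace (EuclideanHalfSpace 2) S] where
  source : Set S
  toFun : S → RP2
  isOpen_source : IsOpen source
  isEmbedding : IsEmbedding (source.domRestrict toFun)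
  interior_mem_nhds : ∀ x ∈ source, (𝓡∂ 2).IsInteriorPoint x → toFun '' source ∈ 𝓝 (toFun x)
  boundary_straight : ∀ x ∈ source, (𝓡∂ 2).IsBoundaryPoint x →
    ∃ ℓ m : (Fin 3 → ℝ) →ₗ[ℝ] ℝ, ℓ ≠ 0 ∧ ℓ (toFun x).rep = 0 ∧ m (toFun x).rep ≠ 0 ∧
      ∀ᶠ q in 𝓝 (toFun x), q ∈ toFun '' source ↔ 0 ≤ ℓ q.rep * m q.rep

variable (S) in
/-- A projective structure on the surface `S`, given by an atlas of projective charts whose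
coordinate changes are locally restrictions of projective transformations. -/
structure ProjectiveStructure [ChartedSpace (EuclideanHalfSpace 2) S] where
  charts : Set (ProjectiveChart S)
  cover : ∀ x : S, ∃ φ ∈ charts, x ∈ φ.source
  compatible : ∀ φ ∈ charts, ∀ ψ ∈ charts, ∀ x ∈ φ.source ∩ ψ.source,
    ∃ M : SL3, ∀ᶠ y in 𝓝 x, ψ.toFun y = M • φ.toFun y

/-! ### Universal coverings, developing maps, monodromy -/

variable {X : Type*} [TopologicalSpace X]

/-- The group of deck transformations of `p : X → S`. When `p` is a universal covering of `S`,
this is the fundamental group of `S` with its action on the universal covering. -/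
def Deck (p : X → S) : Subgroup (X ≃ₜ X) where
  carrier := {g | ∀ x, p (g x) = p x}
  mul_mem' := by
    intro a b ha hb x
    exact (ha (b x)).trans (hb x)
  one_mem' := fun _ => rfl
  inv_mem' := by
    intro a ha x
    have h := ha (a⁻¹ x)
    rw [← h]
    exact congrArg p (a.apply_symm_apply x)

variable [ChartedSpace (EuclideanHalfSpace 2) S]

/-- `dev` is a developing map for `π`: a map from the covering space to the projective plane
which is projective for the lift of `π`. -/
def IsDevelopingMap (p : X → S) (π : ProjectiveStructure S) (dev : X → RP2) : Prop :=
  ∀ φ ∈ π.charts, ∀ x, p x ∈ φ.source →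
    ∃ M : SL3, ∀ᶠ y in 𝓝 x, dev y = M • φ.toFun (p y)

/-- `ρ` is the monodromy of the developing map `dev`. -/
def IsMonodromy (p : X → S) (dev : X → RP2) (ρ : Deck p →* SL3) : Prop :=
  ∀ (γ : Deck p) (x : X), dev (γ.1 x) = ρ γ • dev x

/-- The projective structure is convex: its developing map is a homeomorphism onto a
convex domain of the projective plane. -/
def IsConvexStructure (p : X → S) (π : ProjectiveStructure S) : Prop :=
  ∃ dev : X → RP2, IsDevelopingMap p π dev ∧ IsEmbedding dev ∧ IsConvexInRP2 (Set.range dev)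

/-- Convex projective structures on `S`. -/
abbrev ConvexStructure (p : X → S) : Type _ :=
  {π : ProjectiveStructure S // IsConvexStructure p π}

/-- Two projective structures are isotopic: there is an isotopy of `S`, starting at the identity,
whose endpoint is projective from the first structure to the second one. -/
def IsIsotopic (π π' : ProjectiveStructure S) : Prop :=
  ∃ Φ : unitInterval × S → S, Continuous Φ ∧ (∀ x, Φ (0, x) = x) ∧
    (∀ t, IsHomeomorph fun x => Φ (t, x)) ∧
    ∀ φ ∈ π.charts, ∀ ψ ∈ π'.charts, ∀ x ∈ φ.source, Φ (1, x) ∈ ψ.source →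
      ∃ M : SL3, ∀ᶠ y in 𝓝 x, ψ.toFun (Φ (1, y)) = M • φ.toFun y

/-- The space `𝔓(S)` of isotopy classes of convex projective structures on `S`. -/
def DeformationSpace (p : X → S) : Type _ :=
  Quot fun π π' : ConvexStructure p => IsIsotopic π.1 π'.1

/-- The isotopy class of a convex projective structure. -/
def isotopyClass {p : X → S} (π : ConvexStructure p) : DeformationSpace p :=
  Quot.mk _ π

/-! ### Pair of pants decompositions -/

/-- A decomposition of the oriented surface `S` into pairs of pants, along disjoint simple closed
curves `C_i`, `i : ι`, in the interior of `S`; the boundary components of `S` are indexed by `J`.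

The oriented curve `C_i` is recorded with a tubular neighborhood, as the image of the real line
under an orientation-preserving parametrization `collar i` of an open annulus, which is periodic
of period 1. In particular, the left-hand side of `C_i` corresponds to positive imaginary parts and
its right-hand side to negative ones. The boundary components are similarly recorded with
one-sided collar neighborhoods, and have the boundary orientation. -/
structure PantsDecomposition (o : SurfaceOrientation S) (ι J : Type*) where
  collar : ι → ℂ → S
  collar_continuous : ∀ i, Continuous (collar i)
  collar_isOpenMap : ∀ i, IsOpenMap (collar i)
  collar_eq_iff : ∀ i z w, collar i z = collar i w ↔ ∃ n : ℤ, z = w + n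
  collar_interior : ∀ i z, collar i z ∈ (𝓡∂ 2).interior S
  collar_oriented : ∀ i, ∀ ψ ∈ o.charts, SameOrientationOn Set.univ (collar i) ψ
  collar_disjoint : ∀ i j, i ≠ j → Disjoint (Set.range (collar i)) (Set.range (collar j))
  bdry : J → ℂ → S
  bdry_continuousOn : ∀ j, ContinuousOn (bdry j) {z | 0 ≤ z.im}
  bdry_isOpen : ∀ j, ∀ U : Set ℂ, IsOpen U → IsOpen (bdry j '' (U ∩ {z | 0 ≤ z.im}))
  bdry_eq_iff : ∀ j z w, 0 ≤ z.im → 0 ≤ w.im → (bdry j z = bdry j w ↔ ∃ n : ℤ, z = w + n)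
  bdry_interior : ∀ j z, 0 < z.im → bdry j z ∈ (𝓡∂ 2).interior S
  bdry_boundary : (⋃ j, bdry j '' {z | z.im = 0}) = (𝓡∂ 2).boundary S
  bdry_oriented : ∀ j, ∀ ψ ∈ o.charts, SameOrientationOn {z | 0 < z.im} (bdry j) ψ
  bdry_disjoint : ∀ j k, j ≠ k →
    Disjoint (bdry j '' {z | 0 ≤ z.im}) (bdry k '' {z | 0 ≤ z.im})
  bdry_disjoint_collar : ∀ j i, Disjoint (bdry j '' {z | 0 ≤ z.im}) (Set.range (collar i))
  /-- The interior of each complementary component is a sphere with three punctures. -/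
  pants : ∀ x ∈ (𝓡∂ 2).interior S \ ⋃ i, collar i '' {z | z.im = 0},
    Nonempty (connectedComponentIn ((𝓡∂ 2).interior S \ ⋃ i, collar i '' {z | z.im = 0}) x ≃ₜ
      ({0, 1}ᶜ : Set ℂ))

/-- The ends of the pairs of pants of the decomposition: those on the left-hand side
and on the right-hand side of the curves `C_i`, and those at the boundary components of `S`. -/
inductive PantsEnd (ι J : Type*)
  | left (i : ι)
  | right (i : ι)
  | bdry (j : J)

namespace PantsDecomposition

variable {o : SurfaceOrientation S} {ι J : Type*} (P : PantsDecomposition o ι J)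

/-- The curve `C_i`. -/
def curve (i : ι) : Set S := P.collar i '' {z | z.im = 0}

/-- The complement, in the interior of `S`, of the curves of the decomposition. -/
def pantsRegion : Set S := (𝓡∂ 2).interior S \ ⋃ i, P.curve i

/-- The parametrization, by the upper half plane modulo `z ↦ z + 1`, of an end of a
pair of pants. It is such that the real direction is that of the boundary orientation. -/
def endMap : PantsEnd ι J → ℂ → S
  | .left i => P.collar i
  | .right i => fun z => P.collar i (-z)
  | .bdry j => P.bdry j

/-- The two ends are distinct ends of the same pair of pants. -/
def Adjacent (e e' : PantsEnd ι J) : Prop :=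
  e ≠ e' ∧ connectedComponentIn P.pantsRegion (P.endMap e Complex.I) =
    connectedComponentIn P.pantsRegion (P.endMap e' Complex.I)

end PantsDecomposition

end Surface

/-- As `t → +∞`, the curve `β` spirals along the boundary line of an end parametrized by `η`
on the upper half plane: it approaches this line while going to its positive end. -/
def SpiralsInto {Y : Type*} (β : ℝ → Y) (η : ℂ → Y) : Prop :=
  ∃ z : ℝ → ℂ, Continuous z ∧ (∀ᶠ t in atTop, 0 < (z t).im ∧ β t = η (z t)) ∧
    Tendsto (fun t => (z t).im) atTop (𝓝 0) ∧ Tendsto (fun t => (z t).re) atTop atTop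

section Lamination

variable {S : Type*} [TopologicalSpace S] [ChartedSpace (EuclideanHalfSpace 2) S]
  {o : SurfaceOrientation S} {ι J : Type*}

/-- The lamination `Λ` consisting of the curves of `P`, of the boundary of `S`, and of three
disjoint simple lines in each pair of pants, one for each pair of distinct ends of this pair of
pants. Each line spirals to the left, that is in the direction of the boundary orientation, along the
boundary at both ends. The line `leaf e e'` is parametrized so as to go from `e` to `e'`;
`leaf e' e` is the same line with the opposite orientation. -/
structure SpiralLamination (P : PantsDecomposition o ι J) where
  leaf : PantsEnd ι J → PantsEnd ι J → ℝ → S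
  leaf_continuous : ∀ e e', P.Adjacent e e' → Continuous (leaf e e')
  leaf_injective : ∀ e e', P.Adjacent e e' → Function.Injective (leaf e e')
  leaf_mem : ∀ e e', P.Adjacent e e' → ∀ t, leaf e e' t ∈ P.pantsRegion
  leaf_reverse : ∀ e e', P.Adjacent e e' → ∀ t, leaf e' e t = leaf e e' (-t)
  leaf_spirals : ∀ e e', P.Adjacent e e' → SpiralsInto (leaf e e') (P.endMap e')
  leaf_disjoint : ∀ e e' a a', P.Adjacent e e' → P.Adjacent a a' →
    (a, a') ≠ (e, e') → (a, a') ≠ (e', e) →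
    Disjoint (Set.range (leaf e e')) (Set.range (leaf a a'))

variable {X : Type*} [TopologicalSpace X]

/-- The data in the universal covering that defines the shear invariants along `C_i`: a lift
of `C_i` and a leaf of the preimage of `Λ` on each side of this lift. -/
structure ShearDatum (p : X → S) {P : PantsDecomposition o ι J} (L : SpiralLamination P) (i : ι)
    where
  /-- The lift of `C_i`, as the image of the real line, together with its neighborhood. -/
  line : ℂ → X
  line_continuous : Continuous line
  line_lift : ∀ z, p (line z) = P.collar i z
  /-- The element of the fundamental group represented by `C_i`, preserving this lift. -/
  gen : Deck p
  line_equivariant : ∀ z, line (z + 1) = gen.1 (line z)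
  /-- The other end of the leaf on the left. -/
  endL : PantsEnd ι J
  endL_adjacent : P.Adjacent endL (.left i)
  /-- The leaf on the left, asymptotic to the positive endpoint of the lift of `C_i`. -/
  leafL : ℝ → X
  leafL_continuous : Continuous leafL
  leafL_lift : ∀ t, p (leafL t) = L.leaf endL (.left i) t
  leafL_asymptotic : SpiralsInto leafL line
  /-- The lift of the end of pants to which the leaf on the left goes at its other end. -/
  lineL : ℂ → X
  lineL_continuousOn : ContinuousOn lineL {z | 0 < z.im}
  lineL_lift : ∀ z : ℂ, 0 < z.im → p (lineL z) = P.endMap endL z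
  lineL_asymptotic : SpiralsInto (fun t => leafL (-t)) lineL
  /-- The element of the fundamental group preserving this lift and translating it in
  the direction of the boundary orientation. -/
  genL : Deck p
  lineL_equivariant : ∀ z : ℂ, 0 < z.im → lineL (z + 1) = genL.1 (lineL z)
  /-- The other end of the leaf on the right. -/
  endR : PantsEnd ι J
  endR_adjacent : P.Adjacent endR (.right i)
  /-- The leaf on the right, asymptotic to the negative endpoint of the lift of `C_i`. -/
  leafR : ℝ → X
  leafR_continuous : Continuous leafR
  leafR_lift : ∀ t, p (leafR t) = L.leaf endR (.right i) t
  leafR_asymptotic : SpiralsInto leafR (fun z => line (-z))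
  /-- The lift of the end of pants to which the leaf on the right goes at its other end. -/
  lineR : ℂ → X
  lineR_continuousOn : ContinuousOn lineR {z | 0 < z.im}
  lineR_lift : ∀ z : ℂ, 0 < z.im → p (lineR z) = P.endMap endR z
  lineR_asymptotic : SpiralsInto (fun t => leafR (-t)) lineR
  /-- The element of the fundamental group preserving this lift and translating it in
  the direction of the boundary orientation. -/
  genR : Deck p
  lineR_equivariant : ∀ z : ℂ, 0 < z.im → lineR (z + 1) = genR.1 (lineR z)

end Lamination

/-! ### Flags and shear invariants -/

/-- A flag in `ℝ³`. -/
structure Flag3 where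
  line : Submodule ℝ (Fin 3 → ℝ)
  plane : Submodule ℝ (Fin 3 → ℝ)
  finrank_line : Module.finrank ℝ line = 1
  finrank_plane : Module.finrank ℝ plane = 2
  line_le_plane : line ≤ plane

/-- `f`, `k`, `e` are eigenvectors of `M` for eigenvalues `0 < a < b < c`, in this order. -/
def IsEigenbasis (M : SL3) (f k e : Fin 3 → ℝ) : Prop :=
  f ≠ 0 ∧ k ≠ 0 ∧ e ≠ 0 ∧ ∃ a b c : ℝ, 0 < a ∧ a < b ∧ b < c ∧
    M.1 *ᵥ f = a • f ∧ M.1 *ᵥ k = b • k ∧ M.1 *ᵥ e = c • e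

/-- `F` is the unstable flag of `M`: its line is the eigenspace of the lowest eigenvalue, and its
plane is the sum of the eigenspaces of the two lowest eigenvalues. -/
def IsUnstableFlag (M : SL3) (F : Flag3) : Prop :=
  ∃ f k e, IsEigenbasis M f k e ∧ F.line = Submodule.span ℝ {f} ∧
    F.plane = Submodule.span ℝ {f, k}

/-- The wedge product of three vectors, for the identification of `Λ³ℝ³` with `ℝ` by the
determinant. -/
noncomputable def wedge (u v w : Fin 3 → ℝ) : ℝ := (Matrix.of ![u, v, w]).det

/-- The two shear invariants of the four flags `E`, `F`, `G`, `H` are well-defined (the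
quantities inside the logarithms are positive) and equal to `s₁`, `s₂`. Here `e₁ ∧ e₂` and `f₁ ∧ f₂` are
the elements of the second exterior powers of the planes of `E` and `F`. -/
def HaveShears (E F G H : Flag3) (s₁ s₂ : ℝ) : Prop :=
  ∃ e₁ e₂ f₁ f₂ g h : Fin 3 → ℝ,
    e₁ ≠ 0 ∧ E.line = Submodule.span ℝ {e₁} ∧ E.plane = Submodule.span ℝ {e₁, e₂} ∧
    f₁ ≠ 0 ∧ F.line = Submodule.span ℝ {f₁} ∧ F.plane = Submodule.span ℝ {f₁, f₂} ∧
    g ≠ 0 ∧ G.line = Submodule.span ℝ {g} ∧ h ≠ 0 ∧ H.line = Submodule.span ℝ {h} ∧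
    0 < -(wedge e₁ f₁ g / wedge e₁ f₁ h * (wedge f₁ f₂ h / wedge f₁ f₂ g)) ∧
    s₁ = Real.log (-(wedge e₁ f₁ g / wedge e₁ f₁ h * (wedge f₁ f₂ h / wedge f₁ f₂ g))) ∧
    0 < -(wedge e₁ f₁ h / wedge e₁ f₁ g * (wedge e₁ e₂ g / wedge e₁ e₂ h)) ∧
    s₂ = Real.log (-(wedge e₁ f₁ h / wedge e₁ f₁ g * (wedge e₁ e₂ g / wedge e₁ e₂ h)))

section Main

variable {S : Type*} [TopologicalSpace S] [ChartedSpace (EuclideanHalfSpace 2) S]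
  {o : SurfaceOrientation S} {ι J : Type*} {X : Type*} [TopologicalSpace X] {p : X → S}

/-- The shear invariants `σ₁(C_i)`, `σ₂(C_i)` of the class `x` are `s₁`, `s₂`. Each end of a leaf is
associated with the unstable flag of the monodromy of the boundary curve of the
pair of pants there, oriented opposite to the boundary orientation. The flags `E`, `F`, `G`, `H` are
those at the positive endpoint of the lift of `C_i`, at its negative endpoint, and
at the other endpoints of the leaves on the left and on the right. -/
def HasShearInvariants {P : PantsDecomposition o ι J} {L : SpiralLamination P} {i : ι}
    (d : ShearDatum p L i) (x : DeformationSpace p) (s₁ s₂ : ℝ) : Prop :=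
  ∃ (π : ConvexStructure p) (dev : X → RP2) (ρ : Deck p →* SL3),
    isotopyClass π = x ∧ IsDevelopingMap p π.1 dev ∧ IsMonodromy p dev ρ ∧
    ∃ E F G H : Flag3, IsUnstableFlag (ρ d.gen⁻¹) E ∧ IsUnstableFlag (ρ d.gen) F ∧
      IsUnstableFlag (ρ d.genL⁻¹) G ∧ IsUnstableFlag (ρ d.genR⁻¹) H ∧ HaveShears E F G H s₁ s₂

/-- `T` is the linear map with diagonal entries `t 0`, `t 1`, `t 2` in a basis of eigenvectors
of `M` for eigenvalues `0 < a < b < c`, in this order. -/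
def IsEigenDilation (t : Fin 3 → ℝ) (M T : SL3) : Prop :=
  ∃ f k e, IsEigenbasis M f k e ∧ T.1 *ᵥ f = t 0 • f ∧ T.1 *ᵥ k = t 1 • k ∧ T.1 *ᵥ e = t 2 • e

/-- The class `x'` is obtained from `x` by deforming along the curve `C_i`, composing the charts on
the right-hand side of `C_i` with the linear map with diagonal entries
`t 0`, `t 1`, `t 2` in a basis of eigenvectors of the monodromy of `C_i`.

This is expressed in the universal covering. For suitable structures in the two isotopy classes, the
developing map `dev'` of the second one is obtained, outside of the preimage of some annulus
neighborhood of `C_i` and on each component of the complement of the preimage of `C_i`, by composing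
the developing map `dev` of the first one with a projective transformation `A`; and, when
crossing from left to right a lift of `C_i` preserved by the element `g` of the
fundamental group, `A` gets multiplied on the right by the linear map above for `ρ g`. (In particular,
when `A = 1` on the left of this lift, the modification immediately to the
right is the composition with this linear map. In the annulus, the two pieces are connected
by an arbitrary projective structure, as required by the gluing.) -/
def IsDeformationAlong (P : PantsDecomposition o ι J) (i : ι) (t : Fin 3 → ℝ)
    (x x' : DeformationSpace p) : Prop :=
  ∃ (π π' : ConvexStructure p) (dev dev' : X → RP2) (ρ : Deck p →* SL3) (A : X → SL3) (r : ℝ),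
    isotopyClass π = x ∧ isotopyClass π' = x' ∧
    IsDevelopingMap p π.1 dev ∧ IsMonodromy p dev ρ ∧ IsDevelopingMap p π'.1 dev' ∧
    (∀ y, p y ∉ P.curve i → ∀ᶠ z in 𝓝 y, A z = A y) ∧
    0 ≤ r ∧ (∀ y, p y ∉ P.collar i '' {z | |z.im| ≤ r} → dev' y = A y • dev y) ∧
    ∀ (line : ℂ → X) (g : Deck p), Continuous line → (∀ z, p (line z) = P.collar i z) →
      (∀ z, line (z + 1) = g.1 (line z)) →
      ∀ z w : ℂ, 0 < z.im → w.im < 0 →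
        IsEigenDilation t (ρ g) ((A (line z))⁻¹ * A (line w))

/-- `x'` is the twist deformation `T_{C_i}^u(x)`. -/
def IsTwist (P : PantsDecomposition o ι J) (i : ι) (u : ℝ) (x x' : DeformationSpace p) : Prop :=
  IsDeformationAlong P i ![Real.exp (-u), 1, Real.exp u] x x'

/-- `x'` is the bulge deformation `B_{C_i}^v(x)`. -/
def IsBulge (P : PantsDecomposition o ι J) (i : ι) (v : ℝ) (x x' : DeformationSpace p) : Prop :=
  IsDeformationAlong P i ![Real.exp (-v), Real.exp (2 * v), Real.exp (-v)] x x'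

end Main

end ConvexProjective

namespace ConvexProjective

/-! ### Projective transformations and open subsets of the projective plane -/

/-! Off the preimage of an annulus around $C_i$, the deformed developing map is
$A\cdot\mathrm{dev}$, with $A$ locally constant off the preimage of $C_i$. The monodromy along a
lift of an end of pants is therefore conjugated by the value of $A$ on that lift
(`monodromy_eq_conj_of_end`). The spiraling leaves do not cross the preimage of $C_i$, so $A$ has
one value $a$ along the left leaf and both its ends, and one value $b$ for the right leaf. Hence
$E,F,G$ are moved by $a$ and $H$ by $b$.

By invariance under $\mathrm{SL}_3(\mathbb R)$ (`HaveShears.map`), it is enough to treat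
$(E,F,G,TH)$ with $T=a^{-1}b$, diagonal with entries $t_0,t_1,t_2$ in an eigenbasis $f,k,e$ of
$\rho(C_i)$. Here $E$ comes from $e,k$ and $F$ from $f,k$. Up to scalars, $e^{(1)}\wedge f^{(1)}$,
$f^{(2)}$ and $e^{(2)}$ thus read off the $k$, $e$ and $f$ coordinates of $h^{(1)}$, which $T$
multiplies by $t_1$, $t_2$ and $t_0$. So $\sigma_1$ grows by $\log(t_2/t_1)$ and $\sigma_2$ by
$\log(t_1/t_0)$ (`HaveShears.dilate`).

The invariants also have to be well defined on isotopy classes. The monodromy of a class is unique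
up to conjugation (`exists_conj_of_isotopyClass_eq`): isotopies lift to equivariant maps, and a
projective transformation is determined by its restriction to any set with nonempty interior
(`SL3.eq_of_isThick`). The unstable flags and the shears are then determined by the monodromy. -/

/-- A linear map for which all vectors of a nonempty open set are eigenvectors is a homothety. -/
theorem exists_mulVec_eq_smul_of_isOpen (K : Matrix (Fin 3) (Fin 3) ℝ) {W : Set (Fin 3 → ℝ)}
    (hW : IsOpen W) (hne : W.Nonempty) (h0 : ∀ v ∈ W, v ≠ 0)
    (h : ∀ v ∈ W, ∃ c : ℝ, K *ᵥ v = c • v) : ∃ c : ℝ, ∀ v, K *ᵥ v = c • v := by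
  obtain ⟨w, hw⟩ := hne
  obtain ⟨a, ha⟩ := h w hw
  refine ⟨a, fun u => ?_⟩
  by_cases hu : ∃ c : ℝ, u = c • w
  · obtain ⟨c, rfl⟩ := hu
    rw [Matrix.mulVec_smul, ha, smul_comm]
  -- From here on `u` is not a multiple of `w`, so the two vectors are independent. Comparing the
  -- eigenvalues at `w`, `w + t • u` and `w - t • u` shows that they all coincide.
  have hind : ∀ α β : ℝ, α • w + β • u = 0 → α = 0 ∧ β = 0 := by
    intro α β hab
    have hβ : β = 0 := by
      by_contra hβ
      refine hu ⟨-(β⁻¹ * α), ?_⟩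
      have : u = β⁻¹ • (β • u) := by rw [smul_smul, inv_mul_cancel₀ hβ, one_smul]
      rw [this, eq_neg_of_add_eq_zero_right hab, smul_neg, smul_smul, neg_smul]
    subst hβ
    rw [zero_smul, add_zero] at hab
    exact ⟨(smul_eq_zero.mp hab).resolve_right (h0 w hw), rfl⟩
  have hplus : ∀ᶠ t : ℝ in 𝓝 0, w + t • u ∈ W :=
    (Continuous.tendsto' (by fun_prop) 0 w (by simp)).eventually (hW.mem_nhds hw)
  have hminus : ∀ᶠ t : ℝ in 𝓝 0, w - t • u ∈ W :=
    (Continuous.tendsto' (by fun_prop) 0 w (by simp)).eventually (hW.mem_nhds hw)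
  obtain ⟨t, ⟨htp, htm⟩, ht⟩ :=
    (((hplus.and hminus).filter_mono nhdsWithin_le_nhds).and
      (self_mem_nhdsWithin : Set.Ioi (0 : ℝ) ∈ 𝓝[>] 0)).exists
  have ht : t ≠ 0 := ne_of_gt ht
  obtain ⟨b, hb⟩ := h _ htp
  obtain ⟨c, hc⟩ := h _ htm
  rw [Matrix.mulVec_add, Matrix.mulVec_smul, ha] at hb
  rw [Matrix.mulVec_sub, Matrix.mulVec_smul, ha] at hc
  have key : (2 * a - b - c) • w + (c * t - b * t) • u = 0 := by
    linear_combination (norm := module) hb + hc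
  obtain ⟨h1, h2⟩ := hind _ _ key
  have hbc : c = b := mul_right_cancel₀ ht (sub_eq_zero.mp h2)
  have hab : b = a := by linarith
  subst hab
  have : t • K *ᵥ u = t • (b • u) := by linear_combination (norm := module) hb
  exact smul_right_injective _ ht this

/-- The determinant gives $c^3=1$, whose only real solution is $c=1$. Odd dimension matters: $-1$
lies in $\mathrm{SL}_2(\mathbb R)$. -/
theorem SL3.eq_one_of_mulVec {K : SL3} {c : ℝ} (h : ∀ v, K.1 *ᵥ v = c • v) : K = 1 := by
  have hK : K.1 = c • (1 : Matrix (Fin 3) (Fin 3) ℝ) := by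
    apply Matrix.ext_of_mulVec_single
    intro i
    rw [h, Matrix.smul_mulVec, Matrix.one_mulVec]
  have hdet : c ^ 3 = 1 := by
    have := K.2
    rw [hK, Matrix.det_smul, Matrix.det_one] at this
    simpa using this
  have hc : c = 1 := by nlinarith [sq_nonneg (c + 1), sq_nonneg c]
  apply Subtype.ext
  rw [hK, hc, one_smul, Matrix.SpecialLinearGroup.coe_one]

/-- A subset of the projective plane has nonempty interior, as witnessed in `ℝ³`. -/
def IsThick (s : Set RP2) : Prop :=
  ∃ W : Set (Fin 3 → ℝ), IsOpen W ∧ W.Nonempty ∧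
    ∀ v ∈ W, ∃ hv : v ≠ 0, Projectivization.mk ℝ v hv ∈ s

theorem SL3.smul_mk (M : SL3) {v : Fin 3 → ℝ} (hv : v ≠ 0) (hMv : M.1 *ᵥ v ≠ 0) :
    M • (Projectivization.mk ℝ v hv : RP2) = Projectivization.mk ℝ (M.1 *ᵥ v) hMv :=
  rfl

theorem SL3.mulVec_ne_zero (M : SL3) {v : Fin 3 → ℝ} (hv : v ≠ 0) : M.1 *ᵥ v ≠ 0 :=
  (smul_ne_zero_iff_ne M).mpr hv

/-- Two projective transformations which agree on a set with nonempty interior are equal. -/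
theorem SL3.eq_of_isThick {M N : SL3} {s : Set RP2} (hs : IsThick s)
    (h : ∀ q ∈ s, M • q = N • q) : M = N := by
  obtain ⟨W, hW, hne, hWs⟩ := hs
  have key : ∀ v ∈ W, ∃ c : ℝ, (N⁻¹ * M).1 *ᵥ v = c • v := by
    intro v hv
    obtain ⟨hv0, hvs⟩ := hWs v hv
    have h1 : (N⁻¹ * M) • (Projectivization.mk ℝ v hv0 : RP2) = Projectivization.mk ℝ v hv0 := by
      rw [mul_smul, h _ hvs, inv_smul_smul]
    rw [SL3.smul_mk _ hv0 (SL3.mulVec_ne_zero _ hv0), Projectivization.mk_eq_mk_iff'] at h1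
    obtain ⟨c, hc⟩ := h1
    exact ⟨c, hc.symm⟩
  obtain ⟨c, hc⟩ := exists_mulVec_eq_smul_of_isOpen _ hW hne (fun v hv => (hWs v hv).1) key
  exact (inv_mul_eq_one.mp (SL3.eq_one_of_mulVec hc)).symm

/-- The cone over an open subset of the projective plane is open. -/
theorem RP2.isOpen_cone {V : Set RP2} (hV : IsOpen V) :
    IsOpen {v : Fin 3 → ℝ | ∃ hv : v ≠ 0, Projectivization.mk ℝ v hv ∈ V} := by
  have hc : Continuous fun v : {v : Fin 3 → ℝ // v ≠ 0} =>
      (Quotient.mk (projectivizationSetoid ℝ (Fin 3 → ℝ)) v : RP2) := continuous_quotient_mk'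
  have h1 := (isOpen_compl_singleton (x := (0 : Fin 3 → ℝ))).isOpenMap_subtype_val _
    (hV.preimage hc)
  convert h1 using 1
  ext v
  constructor
  · rintro ⟨hv, hvV⟩
    exact ⟨⟨v, hv⟩, hvV, rfl⟩
  · rintro ⟨⟨v, hv⟩, hvV, rfl⟩
    exact ⟨hv, hvV⟩

theorem isThick_of_mem_nhds {V : Set RP2} {q : RP2} (hV : V ∈ 𝓝 q) : IsThick V := by
  obtain ⟨V', hV', hopen, hq⟩ := mem_nhds_iff.mp hV
  refine ⟨_, RP2.isOpen_cone hopen, ⟨q.rep, q.rep_nonzero, by rwa [q.mk_rep]⟩, ?_⟩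
  rintro v ⟨hv, hvV⟩
  exact ⟨hv, hV' hvV⟩

/-- One side of a line, near a point of this line, has nonempty interior. -/
theorem isThick_halfPlane {V : Set RP2} {q : RP2} (hV : V ∈ 𝓝 q) {ℓ m : (Fin 3 → ℝ) →ₗ[ℝ] ℝ}
    (hℓ : ℓ ≠ 0) (hℓq : ℓ q.rep = 0) (hmq : m q.rep ≠ 0) :
    IsThick (V ∩ {r | 0 ≤ ℓ r.rep * m r.rep}) := by
  obtain ⟨V', hV', hopen, hq⟩ := mem_nhds_iff.mp hV
  obtain ⟨u, hu⟩ : ∃ u, ℓ u = 1 := by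
    obtain ⟨u, hu⟩ := DFunLike.ne_iff.mp hℓ
    exact ⟨(ℓ u)⁻¹ • u, by rw [map_smul, smul_eq_mul, inv_mul_cancel₀ (by simpa using hu)]⟩
  have hℓc : Continuous ℓ := ℓ.continuous_of_finiteDimensional
  have hmc : Continuous m := m.continuous_of_finiteDimensional
  refine ⟨_, (RP2.isOpen_cone hopen).inter
    (isOpen_lt continuous_const (hℓc.mul hmc) : IsOpen {v | 0 < ℓ v * m v}), ?_, ?_⟩
  -- The factor `m q.rep` in the displacement makes the product `ℓ * m` equal to
  -- $t\,m(q)^2(1+t\,m(u))$, which is positive for small $t>0$ whatever the sign of `m q.rep`.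
  · have h1 : ∀ᶠ t : ℝ in 𝓝 0, ∃ hv : q.rep + t • m q.rep • u ≠ 0,
        Projectivization.mk ℝ (q.rep + t • m q.rep • u) hv ∈ V' :=
      (Continuous.tendsto' (f := fun t : ℝ => q.rep + t • m q.rep • u) (by fun_prop) 0 q.rep
        (by simp)).eventually
        ((RP2.isOpen_cone hopen).mem_nhds ⟨q.rep_nonzero, by rwa [q.mk_rep]⟩)
    have h2 : ∀ᶠ t : ℝ in 𝓝 0, 0 < 1 + t * m u :=
      (Continuous.tendsto' (f := fun t : ℝ => 1 + t * m u) (by fun_prop) 0 1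
        (by simp)).eventually (lt_mem_nhds one_pos)
    obtain ⟨t, ⟨ht1, ht2⟩, ht⟩ :=
      (((h1.and h2).filter_mono nhdsWithin_le_nhds).and
        (self_mem_nhdsWithin : Set.Ioi (0 : ℝ) ∈ 𝓝[>] 0)).exists
    refine ⟨_, ht1, ?_⟩
    have ht : 0 < t := ht
    have : ℓ (q.rep + t • m q.rep • u) * m (q.rep + t • m q.rep • u) =
        t * (m q.rep ^ 2 * (1 + t * m u)) := by
      simp only [map_add, map_smul, hℓq, hu, smul_eq_mul]
      ring
    rw [Set.mem_ofPred_eq, this]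
    positivity
  · rintro v ⟨⟨hv, hvV⟩, hpos⟩
    refine ⟨hv, hV' hvV, ?_⟩
    obtain ⟨a, ha⟩ := Projectivization.exists_smul_eq_mk_rep ℝ v hv
    rw [Set.mem_ofPred_eq, ← ha]
    -- The product is homogeneous of even degree, so its sign does not depend on the representative.
    have : ℓ (a • v) * m (a • v) = (a : ℝ) ^ 2 * (ℓ v * m v) := by
      simp only [Units.smul_def, map_smul, smul_eq_mul]
      ring
    rw [this]
    have : 0 < ℓ v * m v := hpos
    positivity

/-! ### Developing maps and monodromy -/

/-- An isotopy of `S` lifts to the universal covering, as a family of maps which commute with the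
deck transformations. -/
theorem exists_lift_isotopy {S X : Type*} [TopologicalSpace S] [TopologicalSpace X] {p : X → S}
    (hp : IsCoveringMap p) {Φ : unitInterval × S → S}
    (hΦ : Continuous Φ) (hΦ0 : ∀ x, Φ (0, x) = x) :
    ∃ Ψ : X → X, Continuous Ψ ∧ (∀ x, p (Ψ x) = Φ (1, p x)) ∧
      ∀ (γ : Deck p) (x : X), Ψ (γ.1 x) = γ.1 (Ψ x) := by
  let H : C(unitInterval × X, S) :=
    ⟨fun tx => Φ (tx.1, p tx.2), hΦ.comp (continuous_fst.prodMk (hp.continuous.comp continuous_snd))⟩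
  have H0 : ∀ x, H (0, x) = p (ContinuousMap.id X x) := fun x => hΦ0 (p x)
  let G := hp.liftHomotopy H (ContinuousMap.id X) H0
  have hG : ∀ tx, p (G tx) = Φ (tx.1, p tx.2) := congrFun (hp.liftHomotopy_lifts H _ H0)
  have hG0 : ∀ x, G (0, x) = x := hp.liftHomotopy_zero H _ H0
  refine ⟨fun x => G (1, x), G.continuous.comp (by fun_prop), fun x => hG (1, x), fun γ x => ?_⟩
  -- Both sides lift the same path of `S` and start at `γ.1 x`, so uniqueness of path lifting
  -- applies.
  have key : (fun t : unitInterval => G (t, γ.1 x)) = fun t => γ.1 (G (t, x)) := by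
    refine hp.eq_of_comp_eq (G.continuous.comp (by fun_prop))
      (γ.1.continuous.comp (G.continuous.comp (by fun_prop))) ?_ 0 ?_
    · funext t
      change p (G (t, γ.1 x)) = p (γ.1 (G (t, x)))
      rw [hG, γ.2 (G (t, x)), hG, γ.2 x]
    · rw [hG0, hG0]
  exact congrFun key 1

section Development

variable {S : Type*} [TopologicalSpace S] [ChartedSpace (EuclideanHalfSpace 2) S]
  {X : Type*} [TopologicalSpace X] {p : X → S}

/-- A projective chart sends each neighborhood of a point of its domain to a subset of the
projective plane with nonempty interior. -/
theorem ProjectiveChart.isThick_image (φ : ProjectiveChart S) {x : S} (hx : x ∈ φ.source)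
    {U : Set S} (hU : U ∈ 𝓝 x) : IsThick (φ.toFun '' (U ∩ φ.source)) := by
  have hU' : Subtype.val ⁻¹' U ∈ 𝓝 (⟨x, hx⟩ : φ.source) :=
    continuous_subtype_val.continuousAt.preimage_mem_nhds hU
  rw [φ.isEmbedding.isInducing.nhds_eq_comap, mem_comap] at hU'
  obtain ⟨V, hV, hVU⟩ := hU'
  have hV : V ∈ 𝓝 (φ.toFun x) := hV
  have hsub : V ∩ φ.toFun '' φ.source ⊆ φ.toFun '' (U ∩ φ.source) := by
    rintro _ ⟨hyV, y, hy, rfl⟩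
    exact ⟨y, ⟨@hVU ⟨y, hy⟩ hyV, hy⟩, rfl⟩
  suffices h : IsThick (V ∩ φ.toFun '' φ.source) by
    obtain ⟨W, hW, hne, hWs⟩ := h
    exact ⟨W, hW, hne, fun v hv => (hWs v hv).imp fun _ h => hsub h⟩
  rcases (𝓡∂ 2).isInteriorPoint_or_isBoundaryPoint x with hi | hb
  · exact isThick_of_mem_nhds (inter_mem hV (φ.interior_mem_nhds x hx hi))
  · obtain ⟨ℓ, m, hℓ, hℓx, hmx, hloc⟩ := φ.boundary_straight x hx hb
    obtain ⟨W, hW, hne, hWs⟩ := isThick_halfPlane (inter_mem hV hloc) hℓ hℓx hmx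
    exact ⟨W, hW, hne, fun v hv => (hWs v hv).imp fun _ h => ⟨h.1.1, h.1.2.mpr h.2⟩⟩

theorem ProjectiveChart.eq_of_eventuallyEq (φ : ProjectiveChart S) {x : S} (hx : x ∈ φ.source)
    {M N : SL3} (h : ∀ᶠ y in 𝓝 x, M • φ.toFun y = N • φ.toFun y) : M = N := by
  refine SL3.eq_of_isThick (φ.isThick_image hx h) ?_
  rintro _ ⟨y, hy, rfl⟩
  exact hy.1

namespace IsDevelopingMap

variable {π : ProjectiveStructure S} {dev dev' : X → RP2}

/-- The rigidity of charts passes to developing maps because `p`, being a local homeomorphism,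
carries neighborhoods of `x` onto neighborhoods of `p x`. -/
theorem eq_of_eventuallyEq (hp : IsCoveringMap p) (hd : IsDevelopingMap p π dev) {x : X}
    {M N : SL3} (h : ∀ᶠ y in 𝓝 x, M • dev y = N • dev y) : M = N := by
  obtain ⟨φ, hφ, hx⟩ := π.cover (p x)
  obtain ⟨K, hK⟩ := hd φ hφ x hx
  refine mul_right_cancel (b := K) (φ.eq_of_eventuallyEq hx ?_)
  rw [← hp.isLocalHomeomorph.map_nhds_eq x, eventually_map]
  filter_upwards [h, hK] with y h1 h2
  rwa [mul_smul, mul_smul, ← h2]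

theorem eventually_eq_smul (hd : IsDevelopingMap p π dev) (hd' : IsDevelopingMap p π dev')
    (x : X) : ∃ N : SL3, ∀ᶠ y in 𝓝 x, dev' y = N • dev y := by
  obtain ⟨φ, hφ, hx⟩ := π.cover (p x)
  obtain ⟨K, hK⟩ := hd φ hφ x hx
  obtain ⟨K', hK'⟩ := hd' φ hφ x hx
  refine ⟨K' * K⁻¹, ?_⟩
  filter_upwards [hK, hK'] with y h1 h2
  rw [h1, h2, mul_smul, inv_smul_smul]

/-- Two developing maps of the same projective structure differ by a projective
transformation. -/
theorem exists_eq_smul [PreconnectedSpace X] (hp : IsCoveringMap p)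
    (hd : IsDevelopingMap p π dev) (hd' : IsDevelopingMap p π dev') :
    ∃ N : SL3, ∀ y, dev' y = N • dev y := by
  choose N hN using hd.eventually_eq_smul hd'
  have hconst : IsLocallyConstant N := by
    rw [IsLocallyConstant.iff_eventually_eq]
    intro x
    filter_upwards [(hN x).eventually_nhds] with y hy
    refine hd.eq_of_eventuallyEq hp (x := y) ?_
    filter_upwards [hy, hN y] with z h1 h2
    rw [← h1, ← h2]
  rcases isEmpty_or_nonempty X with h | ⟨⟨x⟩⟩
  · exact ⟨1, fun y => h.elim y⟩
  · refine ⟨N x, fun y => ?_⟩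
    rw [hconst.apply_eq_of_preconnectedSpace x y]
    exact (hN y).self_of_nhds

theorem comp_deck (hd : IsDevelopingMap p π dev) (γ : Deck p) :
    IsDevelopingMap p π fun x => dev (γ.1 x) := by
  intro φ hφ x hx
  rw [← γ.2 x] at hx
  obtain ⟨M, hM⟩ := hd φ hφ _ hx
  refine ⟨M, ?_⟩
  filter_upwards [γ.1.continuous.continuousAt.eventually hM] with y hy
  rw [hy, γ.2 y]

/-- Each `dev ∘ γ` is again a developing map, hence of the form `ρ γ • dev`; uniqueness of the
matrix makes `ρ` multiplicative. -/
theorem exists_isMonodromy [PreconnectedSpace X] [Nonempty X] (hp : IsCoveringMap p)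
    (hd : IsDevelopingMap p π dev) : ∃ ρ : Deck p →* SL3, IsMonodromy p dev ρ := by
  choose ρ hρ using fun γ : Deck p => hd.exists_eq_smul hp (hd.comp_deck γ)
  obtain ⟨x⟩ := ‹Nonempty X›
  refine ⟨MonoidHom.mk' ρ fun γ δ => ?_, fun γ y => hρ γ y⟩
  refine hd.eq_of_eventuallyEq hp (x := x) (Eventually.of_forall fun y => ?_)
  rw [← hρ (γ * δ) y, mul_smul, ← hρ δ y, ← hρ γ]
  rfl

end IsDevelopingMap

theorem IsMonodromy.conj_of_eq_smul [Nonempty X] (hp : IsCoveringMap p)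
    {π : ProjectiveStructure S} {dev dev' : X → RP2} (hd : IsDevelopingMap p π dev)
    {ρ ρ' : Deck p →* SL3} (hρ : IsMonodromy p dev ρ) (hρ' : IsMonodromy p dev' ρ')
    {N : SL3} (hN : ∀ y, dev' y = N • dev y) (γ : Deck p) : ρ' γ = N * ρ γ * N⁻¹ := by
  obtain ⟨x⟩ := ‹Nonempty X›
  rw [eq_mul_inv_iff_mul_eq]
  refine hd.eq_of_eventuallyEq hp (x := x) (Eventually.of_forall fun y => ?_)
  rw [mul_smul, mul_smul, ← hN, ← hρ', ← hρ, ← hN]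

/-- The monodromies of two isotopic projective structures are conjugate. -/
theorem IsIsotopic.exists_conj [PreconnectedSpace X] [Nonempty X] (hp : IsCoveringMap p)
    {π π' : ProjectiveStructure S} (h : IsIsotopic π π') {dev dev' : X → RP2}
    {ρ ρ' : Deck p →* SL3} (hd : IsDevelopingMap p π dev) (hρ : IsMonodromy p dev ρ)
    (hd' : IsDevelopingMap p π' dev') (hρ' : IsMonodromy p dev' ρ') :
    ∃ N : SL3, ∀ γ, ρ' γ = N * ρ γ * N⁻¹ := by
  obtain ⟨Φ, hΦ, hΦ0, -, hproj⟩ := h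
  obtain ⟨Ψ, hΨ, hΨp, hΨγ⟩ := exists_lift_isotopy hp hΦ hΦ0
  -- Pulling `dev'` back by the lifted isotopy gives a developing map of `π`. Its monodromy is still
  -- `ρ'`, since `Ψ` commutes with the deck transformations.
  have hd₁ : IsDevelopingMap p π fun x => dev' (Ψ x) := by
    intro φ hφ x hx
    obtain ⟨ψ, hψ, hxψ⟩ := π'.cover (Φ (1, p x))
    obtain ⟨M, hM⟩ := hproj φ hφ ψ hψ (p x) hx hxψ
    rw [← hΨp] at hxψ
    obtain ⟨M', hM'⟩ := hd' ψ hψ (Ψ x) hxψ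
    refine ⟨M' * M, ?_⟩
    filter_upwards [hΨ.continuousAt.eventually hM', hp.continuous.continuousAt.eventually hM]
      with y h1 h2
    rw [h1, hΨp, h2, mul_smul]
  have hρ₁ : IsMonodromy p (fun x => dev' (Ψ x)) ρ' := by
    intro γ x
    change dev' (Ψ (γ.1 x)) = _
    rw [hΨγ]
    exact hρ' γ _
  obtain ⟨N, hN⟩ := hd.exists_eq_smul hp hd₁
  exact ⟨N, hρ.conj_of_eq_smul hp hd hρ₁ hN⟩

/-- The monodromy of a convex projective structure depends, up to conjugation, only on its
isotopy class. -/
theorem exists_conj_of_isotopyClass_eq [PreconnectedSpace X] [Nonempty X]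
    (hp : IsCoveringMap p) {π π' : ConvexStructure p} (h : isotopyClass π = isotopyClass π')
    {dev dev' : X → RP2} {ρ ρ' : Deck p →* SL3} (hd : IsDevelopingMap p π.1 dev)
    (hρ : IsMonodromy p dev ρ) (hd' : IsDevelopingMap p π'.1 dev') (hρ' : IsMonodromy p dev' ρ') :
    ∃ N : SL3, ∀ γ, ρ' γ = N * ρ γ * N⁻¹ := by
  -- Equality of classes only gives a chain of isotopies and reversed isotopies, so the conjugation
  -- is built by induction on the generated equivalence relation.
  have hgen := Quot.eqvGen_exact h
  clear h
  induction hgen generalizing dev dev' ρ ρ' with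
  | rel π π' h => exact h.exists_conj hp hd hρ hd' hρ'
  | refl π =>
    obtain ⟨N, hN⟩ := hd.exists_eq_smul hp hd'
    exact ⟨N, hρ.conj_of_eq_smul hp hd hρ' hN⟩
  | symm π π' h ih =>
    obtain ⟨N, hN⟩ := ih hd' hρ' hd hρ
    refine ⟨N⁻¹, fun γ => ?_⟩
    rw [hN]
    group
  | trans π₁ π₂ π₃ h₁ h₂ ih₁ ih₂ =>
    -- Convexity of the intermediate structure supplies its developing map.
    obtain ⟨dev₂, hd₂, -⟩ := π₂.2
    obtain ⟨ρ₂, hρ₂⟩ := hd₂.exists_isMonodromy hp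
    obtain ⟨N, hN⟩ := ih₁ hd hρ hd₂ hρ₂
    obtain ⟨N', hN'⟩ := ih₂ hd₂ hρ₂ hd' hρ'
    refine ⟨N' * N, fun γ => ?_⟩
    rw [hN', hN]
    group

end Development

/-! ### Unstable flags -/

theorem Flag3.ext_of_eq {F F' : Flag3} (h₁ : F.line = F'.line) (h₂ : F.plane = F'.plane) :
    F = F' := by
  cases F
  cases F'
  subst h₁ h₂
  rfl

/-- The image of a flag under a linear map. -/
noncomputable def Flag3.map (M : SL3) (F : Flag3) : Flag3 where
  line := F.line.map (Matrix.SpecialLinearGroup.toLin' M).toLinearMap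
  plane := F.plane.map (Matrix.SpecialLinearGroup.toLin' M).toLinearMap
  finrank_line := by
    rw [LinearEquiv.finrank_map_eq]
    exact F.finrank_line
  finrank_plane := by
    rw [LinearEquiv.finrank_map_eq]
    exact F.finrank_plane
  line_le_plane := Submodule.map_mono F.line_le_plane

theorem Flag3.line_map {F : Flag3} {v : Fin 3 → ℝ} (h : F.line = Submodule.span ℝ {v}) (M : SL3) :
    (F.map M).line = Submodule.span ℝ {M.1 *ᵥ v} := by
  change F.line.map _ = _
  rw [h, Submodule.map_span, Set.image_singleton]
  rfl

theorem Flag3.plane_map {F : Flag3} {v w : Fin 3 → ℝ} (h : F.plane = Submodule.span ℝ {v, w})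
    (M : SL3) : (F.map M).plane = Submodule.span ℝ {M.1 *ᵥ v, M.1 *ᵥ w} := by
  change F.plane.map _ = _
  rw [h, Submodule.map_span, Set.image_pair]
  rfl

namespace IsEigenbasis

variable {M : SL3} {f k e f' k' e' : Fin 3 → ℝ}

theorem linearIndependent (h : IsEigenbasis M f k e) : LinearIndependent ℝ ![f, k, e] := by
  obtain ⟨hf, hk, he, a, b, c, -, hab, hbc, hMf, hMk, hMe⟩ := h
  refine Module.End.eigenvectors_linearIndependent' (Matrix.toLin' M.1) ![a, b, c] ?_ _ ?_
  · intro i j hij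
    fin_cases i <;> fin_cases j <;> simp_all <;> linarith
  · intro i
    rw [Module.End.hasEigenvector_iff, Module.End.mem_eigenspace_iff, Matrix.toLin'_apply]
    fin_cases i
    exacts [⟨hMf, hf⟩, ⟨hMk, hk⟩, ⟨hMe, he⟩]

theorem exists_eq_add (h : IsEigenbasis M f k e) (v : Fin 3 → ℝ) :
    ∃ x y z : ℝ, v = x • f + y • k + z • e := by
  have hspan := h.linearIndependent.span_eq_top_of_card_eq_finrank (by simp)
  have hv : v ∈ Submodule.span ℝ (Set.range ![f, k, e]) := hspan ▸ Submodule.mem_top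
  obtain ⟨c, rfl⟩ := (Submodule.mem_span_range_iff_exists_fun ℝ).mp hv
  exact ⟨c 0, c 1, c 2, by simp [Fin.sum_univ_three]⟩

theorem eq_zero_of_add_eq_zero (h : IsEigenbasis M f k e) {x y z : ℝ}
    (hxyz : x • f + y • k + z • e = 0) : x = 0 ∧ y = 0 ∧ z = 0 := by
  have := Fintype.linearIndependent_iff.mp h.linearIndependent ![x, y, z]
    (by simpa [Fin.sum_univ_three] using hxyz)
  exact ⟨this 0, this 1, this 2⟩

/-- Inversion reverses the order of the eigenvalues. This puts the flags at the two endpoints of the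
lift of $C_i$ in terms of a single eigenbasis: $E$ from $e,k$ and $F$ from $f,k$. -/
theorem inv (h : IsEigenbasis M f k e) : IsEigenbasis M⁻¹ e k f := by
  obtain ⟨hf, hk, he, a, b, c, ha, hab, hbc, hMf, hMk, hMe⟩ := h
  have hinv : ∀ {t : ℝ} {v : Fin 3 → ℝ}, 0 < t → M.1 *ᵥ v = t • v → M⁻¹.1 *ᵥ v = t⁻¹ • v := by
    intro t v ht hv
    have h1 : v = t⁻¹ • M.1 *ᵥ v := by rw [hv, smul_smul, inv_mul_cancel₀ ht.ne', one_smul]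
    conv_lhs => rw [h1]
    rw [Matrix.mulVec_smul, Matrix.mulVec_mulVec, ← Matrix.SpecialLinearGroup.coe_mul,
      inv_mul_cancel, Matrix.SpecialLinearGroup.coe_one, Matrix.one_mulVec]
  have hb := ha.trans hab
  have hc := hb.trans hbc
  exact ⟨he, hk, hf, c⁻¹, b⁻¹, a⁻¹, inv_pos.mpr hc, (inv_lt_inv₀ hc hb).mpr hbc,
    (inv_lt_inv₀ hb ha).mpr hab, hinv hc hMe, hinv hb hMk, hinv ha hMf⟩

theorem conj (h : IsEigenbasis M f k e) (N : SL3) :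
    IsEigenbasis (N * M * N⁻¹) (N.1 *ᵥ f) (N.1 *ᵥ k) (N.1 *ᵥ e) := by
  obtain ⟨hf, hk, he, a, b, c, ha, hab, hbc, hMf, hMk, hMe⟩ := h
  have hconj : ∀ {t : ℝ} {v : Fin 3 → ℝ}, M.1 *ᵥ v = t • v →
      (N * M * N⁻¹).1 *ᵥ (N.1 *ᵥ v) = t • N.1 *ᵥ v := by
    intro t v hv
    rw [Matrix.mulVec_mulVec, ← Matrix.SpecialLinearGroup.coe_mul, inv_mul_cancel_right,
      Matrix.SpecialLinearGroup.coe_mul, ← Matrix.mulVec_mulVec, hv, Matrix.mulVec_smul]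
  exact ⟨SL3.mulVec_ne_zero N hf, SL3.mulVec_ne_zero N hk, SL3.mulVec_ne_zero N he, a, b, c,
    ha, hab, hbc, hconj hMf, hconj hMk, hconj hMe⟩

/-- The eigenvectors are unique up to scalars. -/
theorem exists_eq_smul (h : IsEigenbasis M f k e) (h' : IsEigenbasis M f' k' e') :
    (∃ x : ℝ, x ≠ 0 ∧ f' = x • f) ∧ (∃ y : ℝ, y ≠ 0 ∧ k' = y • k) ∧
      ∃ z : ℝ, z ≠ 0 ∧ e' = z • e := by
  have hbasis := h
  obtain ⟨-, -, -, a, b, c, -, hab, hbc, hMf, hMk, hMe⟩ := h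
  obtain ⟨hf', hk', he', a', b', c', -, hab', hbc', hMf', hMk', hMe'⟩ := h'
  have key : ∀ {t : ℝ} {v : Fin 3 → ℝ}, v ≠ 0 → M.1 *ᵥ v = t • v →
      (t = a ∧ ∃ x : ℝ, x ≠ 0 ∧ v = x • f) ∨ (t = b ∧ ∃ x : ℝ, x ≠ 0 ∧ v = x • k) ∨
        (t = c ∧ ∃ x : ℝ, x ≠ 0 ∧ v = x • e) := by
    intro t v hv hMv
    obtain ⟨x, y, z, rfl⟩ := hbasis.exists_eq_add v
    rw [Matrix.mulVec_add, Matrix.mulVec_add, Matrix.mulVec_smul, Matrix.mulVec_smul,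
      Matrix.mulVec_smul, hMf, hMk, hMe] at hMv
    obtain ⟨h1, h2, h3⟩ := hbasis.eq_zero_of_add_eq_zero
      (x := x * (a - t)) (y := y * (b - t)) (z := z * (c - t))
      (by linear_combination (norm := module) hMv)
    by_cases hx : x = 0
    · by_cases hy : y = 0
      · have hz : z ≠ 0 := by
          rintro rfl
          simp [hx, hy] at hv
        refine Or.inr (Or.inr ⟨?_, z, hz, by simp [hx, hy]⟩)
        linarith [(mul_eq_zero.mp h3).resolve_left hz]
      · have ht : t = b := by linarith [(mul_eq_zero.mp h2).resolve_left hy]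
        have hz : z = 0 := (mul_eq_zero.mp h3).resolve_right (by rw [ht]; linarith)
        exact Or.inr (Or.inl ⟨ht, y, hy, by simp [hx, hz]⟩)
    · have ht : t = a := by linarith [(mul_eq_zero.mp h1).resolve_left hx]
      have hy : y = 0 := (mul_eq_zero.mp h2).resolve_right (by rw [ht]; linarith)
      have hz : z = 0 := (mul_eq_zero.mp h3).resolve_right (by rw [ht]; linarith)
      exact Or.inl ⟨ht, x, hx, by simp [hy, hz]⟩
  have hac := hab.trans hbc
  have hac' := hab'.trans hbc'
  -- Of the 27 ways to match the eigenvalues, only the order-preserving one is compatible with `a' <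
  -- b' < c'`.
  rcases key hf' hMf' with ⟨h1, hx⟩ | ⟨h1, hx⟩ | ⟨h1, hx⟩ <;>
  rcases key hk' hMk' with ⟨h2, hy⟩ | ⟨h2, hy⟩ | ⟨h2, hy⟩ <;>
  rcases key he' hMe' with ⟨h3, hz⟩ | ⟨h3, hz⟩ | ⟨h3, hz⟩ <;>
  first
  | exact ⟨hx, hy, hz⟩
  | (exfalso; linarith)

theorem line_eq (h : IsEigenbasis M f k e) {F : Flag3} (hF : IsUnstableFlag M F) :
    F.line = Submodule.span ℝ {f} := by
  obtain ⟨f', k', e', h', hl, -⟩ := hF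
  obtain ⟨⟨x, hx, rfl⟩, -⟩ := h.exists_eq_smul h'
  rw [hl, Submodule.span_singleton_smul_eq (Ne.isUnit hx)]

theorem plane_eq (h : IsEigenbasis M f k e) {F : Flag3} (hF : IsUnstableFlag M F) :
    F.plane = Submodule.span ℝ {f, k} := by
  obtain ⟨f', k', e', h', -, hpl⟩ := hF
  obtain ⟨⟨x, hx, rfl⟩, ⟨y, hy, rfl⟩, -⟩ := h.exists_eq_smul h'
  rw [hpl, Submodule.span_insert, Submodule.span_insert,
    Submodule.span_singleton_smul_eq (Ne.isUnit hx), Submodule.span_singleton_smul_eq (Ne.isUnit hy)]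

end IsEigenbasis

theorem IsUnstableFlag.eq {M : SL3} {F F' : Flag3} (h : IsUnstableFlag M F)
    (h' : IsUnstableFlag M F') : F = F' := by
  obtain ⟨f, k, e, hb, hl, hpl⟩ := h
  exact Flag3.ext_of_eq (hl.trans (hb.line_eq h').symm) (hpl.trans (hb.plane_eq h').symm)

theorem IsUnstableFlag.map {M : SL3} {F : Flag3} (h : IsUnstableFlag M F) (N : SL3) :
    IsUnstableFlag (N * M * N⁻¹) (F.map N) := by
  obtain ⟨f, k, e, hb, hl, hpl⟩ := h
  exact ⟨_, _, _, hb.conj N, Flag3.line_map hl N, Flag3.plane_map hpl N⟩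

/-! ### Shear invariants of four flags -/

theorem wedge_mulVec (M : SL3) (u v w : Fin 3 → ℝ) :
    wedge (M.1 *ᵥ u) (M.1 *ᵥ v) (M.1 *ᵥ w) = wedge u v w := by
  have h : wedge (M.1 *ᵥ u) (M.1 *ᵥ v) (M.1 *ᵥ w) = M.1.det * wedge u v w := by
    simp only [wedge, Matrix.det_fin_three, Matrix.mulVec, dotProduct, Fin.sum_univ_three,
      Matrix.of_apply, Matrix.cons_val]
    ring
  rw [h, M.2, one_mul]

theorem wedge_smul_left (c : ℝ) (u v w : Fin 3 → ℝ) : wedge (c • u) v w = c * wedge u v w := by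
  simp only [wedge, Matrix.det_fin_three, Matrix.of_apply, Matrix.cons_val, Pi.smul_apply,
    smul_eq_mul]
  ring

theorem wedge_smul_middle (c : ℝ) (u v w : Fin 3 → ℝ) :
    wedge u (c • v) w = c * wedge u v w := by
  simp only [wedge, Matrix.det_fin_three, Matrix.of_apply, Matrix.cons_val, Pi.smul_apply,
    smul_eq_mul]
  ring

theorem wedge_smul_right (c : ℝ) (u v w : Fin 3 → ℝ) : wedge u v (c • w) = c * wedge u v w := by
  simp only [wedge, Matrix.det_fin_three, Matrix.of_apply, Matrix.cons_val, Pi.smul_apply,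
    smul_eq_mul]
  ring

theorem exists_eq_smul_of_span_eq {u v : Fin 3 → ℝ} (hv : v ≠ 0)
    (h : Submodule.span ℝ {u} = Submodule.span ℝ {v}) : ∃ c : ℝ, c ≠ 0 ∧ v = c • u := by
  have hmem : v ∈ Submodule.span ℝ {u} := h ▸ Submodule.mem_span_singleton_self v
  obtain ⟨c, rfl⟩ := Submodule.mem_span_singleton.mp hmem
  exact ⟨c, fun hc => hv (by rw [hc, zero_smul]), rfl⟩

/-- The constant is the determinant of the change of generators. It is not claimed to be nonzero, as
the pairs are not assumed independent. -/
theorem exists_wedge_eq_of_span_eq {u₁ u₂ v₁ v₂ : Fin 3 → ℝ}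
    (h : Submodule.span ℝ {u₁, u₂} = Submodule.span ℝ {v₁, v₂}) :
    ∃ c : ℝ, ∀ w, wedge v₁ v₂ w = c * wedge u₁ u₂ w := by
  have h1 : v₁ ∈ Submodule.span ℝ {u₁, u₂} := h ▸ Submodule.subset_span (by simp)
  have h2 : v₂ ∈ Submodule.span ℝ {u₁, u₂} := h ▸ Submodule.subset_span (by simp)
  obtain ⟨a, b, rfl⟩ := Submodule.mem_span_pair.mp h1
  obtain ⟨c, d, rfl⟩ := Submodule.mem_span_pair.mp h2
  refine ⟨a * d - b * c, fun w => ?_⟩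
  simp only [wedge, Matrix.det_fin_three, Matrix.of_apply, Matrix.cons_val, Pi.smul_apply,
    Pi.add_apply, smul_eq_mul]
  ring

variable {E F G H : Flag3} {s₁ s₂ : ℝ}

/-- In each invariant every chosen vector or bivector occurs once in a numerator and once in a
denominator, so rescaling it has no effect. -/
theorem HaveShears.unique {s₁' s₂' : ℝ} (h : HaveShears E F G H s₁ s₂)
    (h' : HaveShears E F G H s₁' s₂') : s₁' = s₁ ∧ s₂' = s₂ := by
  obtain ⟨e₁, e₂, f₁, f₂, g, h, -, hE, hE₂, -, hF, hF₂, -, hG, -, hH, hp₁, rfl, hp₂, rfl⟩ := h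
  obtain ⟨e₁', e₂', f₁', f₂', g', h', he, hE', hE₂', hf, hF', hF₂', hg, hG', hh, hH', hp₁', rfl,
    hp₂', rfl⟩ := h'
  obtain ⟨ce, hce, rfl⟩ := exists_eq_smul_of_span_eq he (hE.symm.trans hE')
  obtain ⟨cf, hcf, rfl⟩ := exists_eq_smul_of_span_eq hf (hF.symm.trans hF')
  obtain ⟨cg, hcg, rfl⟩ := exists_eq_smul_of_span_eq hg (hG.symm.trans hG')
  obtain ⟨ch, hch, rfl⟩ := exists_eq_smul_of_span_eq hh (hH.symm.trans hH')
  obtain ⟨ce₂, he₂⟩ := exists_wedge_eq_of_span_eq (hE₂.symm.trans hE₂')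
  obtain ⟨cf₂, hf₂⟩ := exists_wedge_eq_of_span_eq (hF₂.symm.trans hF₂')
  simp only [he₂, hf₂, wedge_smul_left, wedge_smul_middle, wedge_smul_right] at hp₁' hp₂' ⊢
  -- A zero constant would make the quantity inside the logarithm vanish, against its positivity.
  have hcf₂ : cf₂ ≠ 0 := by
    rintro rfl
    simp at hp₁'
  have hce₂ : ce₂ ≠ 0 := by
    rintro rfl
    simp at hp₂'
  constructor <;> congr 2 <;>
  · simp only [mul_div_mul_comm, div_self hce, div_self hcf, div_self hce₂, div_self hcf₂, one_mul]
    field_simp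

theorem HaveShears.map (h : HaveShears E F G H s₁ s₂) (M : SL3) :
    HaveShears (E.map M) (F.map M) (G.map M) (H.map M) s₁ s₂ := by
  obtain ⟨e₁, e₂, f₁, f₂, g, h, he, hE, hE₂, hf, hF, hF₂, hg, hG, hh, hH, hs⟩ := h
  refine ⟨M.1 *ᵥ e₁, M.1 *ᵥ e₂, M.1 *ᵥ f₁, M.1 *ᵥ f₂, M.1 *ᵥ g, M.1 *ᵥ h,
    SL3.mulVec_ne_zero M he, Flag3.line_map hE M, Flag3.plane_map hE₂ M,
    SL3.mulVec_ne_zero M hf, Flag3.line_map hF M, Flag3.plane_map hF₂ M,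
    SL3.mulVec_ne_zero M hg, Flag3.line_map hG M, SL3.mulVec_ne_zero M hh, Flag3.line_map hH M, ?_⟩
  simpa only [wedge_mulVec] using hs

/-- The effect on the shear invariants of a linear map which is diagonal in the basis defined by
the flags `E` and `F`, when applied to the flag `H`. -/
theorem HaveShears.dilate (hs : HaveShears E F G H s₁ s₂) {K T : SL3} {t : Fin 3 → ℝ}
    (ht : ∀ j, 0 < t j) (hT : IsEigenDilation t K T) (hE : IsUnstableFlag K⁻¹ E)
    (hF : IsUnstableFlag K F) :
    HaveShears E F G (H.map T) (s₁ + Real.log (t 2 / t 1)) (s₂ + Real.log (t 1 / t 0)) := by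
  obtain ⟨f, k, e, hb, hTf, hTk, hTe⟩ := hT
  obtain ⟨e₁, e₂, f₁, f₂, g, h, he, hE₁, hE₂, hf, hF₁, hF₂, hg, hG, hh, hH, hp₁, rfl, hp₂, rfl⟩ :=
    hs
  obtain ⟨ce, -, rfl⟩ := exists_eq_smul_of_span_eq he ((hb.inv.line_eq hE).symm.trans hE₁)
  obtain ⟨cf, -, rfl⟩ := exists_eq_smul_of_span_eq hf ((hb.line_eq hF).symm.trans hF₁)
  obtain ⟨ce₂, hce₂⟩ := exists_wedge_eq_of_span_eq ((hb.inv.plane_eq hE).symm.trans hE₂)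
  obtain ⟨cf₂, hcf₂⟩ := exists_wedge_eq_of_span_eq ((hb.plane_eq hF).symm.trans hF₂)
  obtain ⟨x, y, z, rfl⟩ := hb.exists_eq_add h
  have hTh : T.1 *ᵥ (x • f + y • k + z • e) = (t 0 * x) • f + (t 1 * y) • k + (t 2 * z) • e := by
    rw [Matrix.mulVec_add, Matrix.mulVec_add, Matrix.mulVec_smul, Matrix.mulVec_smul,
      Matrix.mulVec_smul, hTf, hTk, hTe]
    module
  -- The wedge with `e`, `f` sees only the `k`-coordinate, that with `f`, `f₂` only the
  -- `e`-coordinate, and that with `e`, `e₂` only the `f`-coordinate; hence the factors `t 1`, `t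
  -- 2`, `t 0`.
  have hef : wedge (ce • e) (cf • f) (T.1 *ᵥ (x • f + y • k + z • e)) =
      t 1 * wedge (ce • e) (cf • f) (x • f + y • k + z • e) := by
    rw [hTh]
    simp only [wedge, Matrix.det_fin_three, Matrix.of_apply, Matrix.cons_val, Pi.smul_apply,
      Pi.add_apply, smul_eq_mul]
    ring
  have hff : wedge (cf • f) f₂ (T.1 *ᵥ (x • f + y • k + z • e)) =
      t 2 * wedge (cf • f) f₂ (x • f + y • k + z • e) := by
    rw [hTh, hcf₂, hcf₂]
    simp only [wedge, Matrix.det_fin_three, Matrix.of_apply, Matrix.cons_val, Pi.smul_apply,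
      Pi.add_apply, smul_eq_mul]
    ring
  have hee : wedge (ce • e) e₂ (T.1 *ᵥ (x • f + y • k + z • e)) =
      t 0 * wedge (ce • e) e₂ (x • f + y • k + z • e) := by
    rw [hTh, hce₂, hce₂]
    simp only [wedge, Matrix.det_fin_three, Matrix.of_apply, Matrix.cons_val, Pi.smul_apply,
      Pi.add_apply, smul_eq_mul]
    ring
  have h21 : 0 < t 2 / t 1 := div_pos (ht 2) (ht 1)
  have h10 : 0 < t 1 / t 0 := div_pos (ht 1) (ht 0)
  refine ⟨ce • e, e₂, cf • f, f₂, g, T.1 *ᵥ (x • f + y • k + z • e), he, hE₁, hE₂, hf, hF₁, hF₂,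
    hg, hG, SL3.mulVec_ne_zero T hh, Flag3.line_map hH T, ?_⟩
  rw [hef, hff, hee, ← Real.log_mul hp₁.ne' h21.ne', ← Real.log_mul hp₂.ne' h10.ne']
  have h1 : ∀ a b c d : ℝ, -(a / (t 1 * b) * (t 2 * c / d)) = -(a / b * (c / d)) * (t 2 / t 1) := by
    intro a b c d
    ring
  have h2 : ∀ a b c d : ℝ, -(t 1 * a / b * (c / (t 0 * d))) = -(a / b * (c / d)) * (t 1 / t 0) := by
    intro a b c d
    ring
  rw [h1, h2]
  exact ⟨mul_pos hp₁ h21, rfl, mul_pos hp₂ h10, rfl⟩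

theorem Flag3.map_map (M N : SL3) (F : Flag3) : (F.map N).map M = F.map (M * N) := by
  have h : (Matrix.SpecialLinearGroup.toLin' (M * N)).toLinearMap =
      (Matrix.SpecialLinearGroup.toLin' M).toLinearMap ∘ₗ
        (Matrix.SpecialLinearGroup.toLin' N).toLinearMap := by
    rw [map_mul]
    rfl
  apply Flag3.ext_of_eq
  · change (F.line.map _).map _ = F.line.map _
    rw [h, Submodule.map_comp]
  · change (F.plane.map _).map _ = F.plane.map _
    rw [h, Submodule.map_comp]

/-! ### Ends of the pairs of pants and annuli around the curves -/

section Pants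

variable {S : Type*} [TopologicalSpace S] [ChartedSpace (EuclideanHalfSpace 2) S]
  {o : SurfaceOrientation S} {ι J : Type*}

namespace PantsDecomposition

variable (P : PantsDecomposition o ι J)

/-- By periodicity the annulus is the image of a compact rectangle, hence compact, hence closed in a
Hausdorff space. -/
theorem isClosed_annulus [T2Space S] (i : ι) (r : ℝ) :
    IsClosed (P.collar i '' {z | |z.im| ≤ r}) := by
  have h : P.collar i '' {z | |z.im| ≤ r} = P.collar i '' (Set.Icc 0 1 ×ℂ Set.Icc (-r) r) := by
    apply Set.Subset.antisymm
    · rintro _ ⟨z, hz, rfl⟩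
      refine ⟨z + (-⌊z.re⌋ : ℤ), ?_, (P.collar_eq_iff i _ _).mpr ⟨_, rfl⟩⟩
      rw [Complex.mem_reProdIm, Complex.add_re, Complex.add_im, Complex.intCast_re,
        Complex.intCast_im, add_zero]
      refine ⟨⟨?_, ?_⟩, abs_le.mp hz⟩ <;> push_cast
      · linarith [Int.floor_le z.re]
      · linarith [Int.lt_floor_add_one z.re]
    · rintro _ ⟨z, hz, rfl⟩
      exact ⟨z, abs_le.mpr (Complex.mem_reProdIm.mp hz).2, rfl⟩
  rw [h]
  exact ((isCompact_Icc.reProdIm isCompact_Icc).image (P.collar_continuous i)).isClosed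

theorem collar_notMem_annulus (i : ι) {r : ℝ} {z : ℂ} (hz : r < |z.im|) :
    P.collar i z ∉ P.collar i '' {z | |z.im| ≤ r} := by
  rintro ⟨w, hw, hwz⟩
  obtain ⟨n, rfl⟩ := (P.collar_eq_iff i _ _).mp hwz
  rw [Set.mem_ofPred_eq, Complex.add_im, Complex.intCast_im, add_zero] at hw
  exact absurd hw (not_le.mpr hz)

/-- An end at $C_i$ is separated from the annulus by height, since the collar identifies only points
of equal imaginary part; any other end has a collar disjoint from that of $C_i$. -/
theorem endMap_notMem_annulus (e : PantsEnd ι J) (i : ι) {r : ℝ} {z : ℂ} (hz : 0 < z.im)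
    (hr : r < z.im) : P.endMap e z ∉ P.collar i '' {z | |z.im| ≤ r} := by
  have hsub : P.collar i '' {z | |z.im| ≤ r} ⊆ Set.range (P.collar i) := Set.image_subset_range _ _
  have hcollar : ∀ (j : ι) (w : ℂ), |w.im| = z.im →
      P.collar j w ∉ P.collar i '' {z | |z.im| ≤ r} := by
    intro j w hw
    by_cases hij : j = i
    · subst hij
      exact P.collar_notMem_annulus j (hw ▸ hr)
    · exact fun h => Set.disjoint_left.mp (P.collar_disjoint j i hij) ⟨w, rfl⟩ (hsub h)
  cases e with
  | left j => exact hcollar j z (abs_of_pos hz)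
  | right j => exact hcollar j (-z) (by rw [Complex.neg_im, abs_neg, abs_of_pos hz])
  | bdry j =>
    intro h
    exact Set.disjoint_left.mp (P.bdry_disjoint_collar j i) ⟨z, hz.le, rfl⟩ (hsub h)

theorem curve_subset_annulus (i : ι) {r : ℝ} (hr : 0 ≤ r) :
    P.curve i ⊆ P.collar i '' {z | |z.im| ≤ r} :=
  Set.image_mono fun z (hz : z.im = 0) => by rwa [Set.mem_ofPred_eq, hz, abs_zero]

theorem endMap_notMem_curve (e : PantsEnd ι J) (i : ι) {z : ℂ} (hz : 0 < z.im) :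
    P.endMap e z ∉ P.curve i :=
  fun h => P.endMap_notMem_annulus e i hz hz (P.curve_subset_annulus i le_rfl h)

theorem notMem_curve_of_mem_pantsRegion {y : S} (hy : y ∈ P.pantsRegion) (i : ι) :
    y ∉ P.curve i :=
  fun h => hy.2 (Set.mem_iUnion_of_mem i h)

end PantsDecomposition

end Pants

/-- A locally constant function on a set is constant along a connected family of points of this
set. -/
theorem eq_of_isPreconnected {X Y Z : Type*} [TopologicalSpace X] [TopologicalSpace Y] {A : X → Z}
    {U : Set X} (hA : ∀ y ∈ U, ∀ᶠ z in 𝓝 y, A z = A y) {s : Set Y} (hs : IsPreconnected s)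
    {β : Y → X} (hβ : ContinuousOn β s) (hU : ∀ a ∈ s, β a ∈ U) {a b : Y} (ha : a ∈ s)
    (hb : b ∈ s) : A (β a) = A (β b) := by
  have := Subtype.preconnectedSpace hs
  have hconst : IsLocallyConstant fun a : s => A (β a) := by
    rw [IsLocallyConstant.iff_eventually_eq]
    intro x
    exact (continuousOn_iff_continuous_domRestrict.mp hβ).continuousAt.eventually (hA _ (hU x x.2))
  exact hconst.apply_eq_of_preconnectedSpace ⟨a, ha⟩ ⟨b, hb⟩

theorem isPreconnected_upperHalfPlane : IsPreconnected {z : ℂ | 0 < z.im} :=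
  (convex_halfSpace_im_gt 0).isPreconnected

/-! ### Effect of a deformation on the monodromy and on the shear invariants -/

section Deformation

variable {S : Type*} [TopologicalSpace S] [ChartedSpace (EuclideanHalfSpace 2) S]
  {o : SurfaceOrientation S} {ι J : Type*} {X : Type*} [TopologicalSpace X] {p : X → S}

/-- Along the lift of an end of a pair of pants, on which the deformation is the composition with
a projective transformation `a`, the monodromy is conjugated by `a`. -/
theorem monodromy_eq_conj_of_end [T2Space S] (hp : IsCoveringMap p)
    {P : PantsDecomposition o ι J} {i : ι} {π : ProjectiveStructure S} {dev dev' : X → RP2}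
    {ρ ρ' : Deck p →* SL3} {A : X → SL3} {r : ℝ} (hd : IsDevelopingMap p π dev)
    (hρ : IsMonodromy p dev ρ) (hρ' : IsMonodromy p dev' ρ')
    (hA : ∀ y, p y ∉ P.curve i → ∀ᶠ z in 𝓝 y, A z = A y) (hr : 0 ≤ r)
    (hdev : ∀ y, p y ∉ P.collar i '' {z | |z.im| ≤ r} → dev' y = A y • dev y)
    {e : PantsEnd ι J} {line : ℂ → X} (hline : ∀ z : ℂ, 0 < z.im → p (line z) = P.endMap e z)
    {γ : Deck p} (hγ : ∀ z : ℂ, 0 < z.im → line (z + 1) = γ.1 (line z)) {a : SL3}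
    (ha : ∀ z : ℂ, 0 < z.im → A (line z) = a) : ρ' γ = a * ρ γ * a⁻¹ := by
  -- A point of the end high enough to be outside the annulus, where `dev'` is known.
  obtain ⟨z, hz0, hzr⟩ : ∃ z : ℂ, 0 < z.im ∧ r < z.im :=
    ⟨⟨0, r + 1⟩, by change 0 < r + 1; linarith, by change r < r + 1; linarith⟩
  have hz1 : 0 < (z + 1).im := by simpa using hz0
  have hann : p (line z) ∉ P.collar i '' {z | |z.im| ≤ r} := by
    rw [hline z hz0]
    exact P.endMap_notMem_annulus e i hz0 hzr
  have hfar : ∀ᶠ y in 𝓝 (line z), p y ∉ P.collar i '' {z | |z.im| ≤ r} :=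
    hp.continuous.continuousAt.eventually ((P.isClosed_annulus i r).isOpen_compl.mem_nhds hann)
  have hA₀ := hA (line z) (fun h => hann (P.curve_subset_annulus i hr h))
  have hA₁ : ∀ᶠ y in 𝓝 (γ.1 (line z)), A y = A (γ.1 (line z)) := by
    refine hA _ fun h => hann (P.curve_subset_annulus i hr ?_)
    rwa [γ.2] at h
  -- Near this point `dev' (γ.1 y)` equals both `ρ' γ • a • dev y` and `a • ρ γ • dev y`, because
  -- `A` is equal to `a` near `line z` and near its image by `γ`.
  rw [eq_mul_inv_iff_mul_eq]
  refine hd.eq_of_eventuallyEq hp (x := line z) ?_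
  filter_upwards [hfar, hA₀, γ.1.continuous.continuousAt.eventually hA₁] with y h1 h2 h3
  rw [ha z hz0] at h2
  rw [← hγ z hz0, ha _ hz1] at h3
  have h4 := hdev y h1
  have h5 := hdev (γ.1 y) (by rwa [γ.2])
  rw [h2] at h4
  rw [h3] at h5
  rw [mul_smul, mul_smul, ← h4, ← hρ', ← hρ, h5]

/-- The shear invariants can be computed from an arbitrary structure in the isotopy class. -/
theorem HasShearInvariants.exists_flags [PreconnectedSpace X] [Nonempty X] (hp : IsCoveringMap p)
    {P : PantsDecomposition o ι J} {L : SpiralLamination P} {i : ι} {d : ShearDatum p L i}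
    {x : DeformationSpace p} {s₁ s₂ : ℝ} (h : HasShearInvariants d x s₁ s₂) {π : ConvexStructure p}
    (hπ : isotopyClass π = x) {dev : X → RP2} {ρ : Deck p →* SL3}
    (hd : IsDevelopingMap p π.1 dev) (hρ : IsMonodromy p dev ρ) :
    ∃ E F G H : Flag3, IsUnstableFlag (ρ d.gen⁻¹) E ∧ IsUnstableFlag (ρ d.gen) F ∧
      IsUnstableFlag (ρ d.genL⁻¹) G ∧ IsUnstableFlag (ρ d.genR⁻¹) H ∧
      HaveShears E F G H s₁ s₂ := by
  obtain ⟨π₀, dev₀, ρ₀, hπ₀, hd₀, hρ₀, E, F, G, H, hE, hF, hG, hH, hs⟩ := h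
  obtain ⟨N, hN⟩ := exists_conj_of_isotopyClass_eq hp (hπ₀.trans hπ.symm) hd₀ hρ₀ hd hρ
  refine ⟨E.map N, F.map N, G.map N, H.map N, ?_, ?_, ?_, ?_, hs.map N⟩
  · exact hN _ ▸ hE.map N
  · exact hN _ ▸ hF.map N
  · exact hN _ ▸ hG.map N
  · exact hN _ ▸ hH.map N

/-- Both pairs of values can be computed from one developing map, and there the unstable flags are
determined by the monodromy. -/
theorem HasShearInvariants.unique [PreconnectedSpace X] [Nonempty X] (hp : IsCoveringMap p)
    {P : PantsDecomposition o ι J} {L : SpiralLamination P} {i : ι} {d : ShearDatum p L i}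
    {x : DeformationSpace p} {s₁ s₂ s₁' s₂' : ℝ} (h : HasShearInvariants d x s₁ s₂)
    (h' : HasShearInvariants d x s₁' s₂') : s₁' = s₁ ∧ s₂' = s₂ := by
  obtain ⟨π, dev, ρ, hπ, hd, hρ, E', F', G', H', hE', hF', hG', hH', hs'⟩ := h'
  obtain ⟨E, F, G, H, hE, hF, hG, hH, hs⟩ := h.exists_flags hp hπ hd hρ
  rw [hE'.eq hE, hF'.eq hF, hG'.eq hG, hH'.eq hH] at hs'
  exact hs.unique hs'

/-- The effect on the shear invariants of the deformation along `C_i`. -/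
theorem IsDeformationAlong.hasShearInvariants [T2Space S] [PreconnectedSpace X] [Nonempty X]
    (hp : IsCoveringMap p) {P : PantsDecomposition o ι J} {L : SpiralLamination P} {i : ι}
    (d : ShearDatum p L i) {t : Fin 3 → ℝ} (ht : ∀ j, 0 < t j) {x x' : DeformationSpace p}
    (hdef : IsDeformationAlong P i t x x') {σ₁ σ₂ : ℝ} (hx : HasShearInvariants d x σ₁ σ₂) :
    HasShearInvariants d x' (σ₁ + Real.log (t 2 / t 1)) (σ₂ + Real.log (t 1 / t 0)) := by
  obtain ⟨π, π', dev, dev', ρ, A, r, hπ, hπ', hd, hρ, hd', hA, hr, hdev, hdil⟩ := hdef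
  obtain ⟨E, F, G, H, hE, hF, hG, hH, hs⟩ := hx.exists_flags hp hπ hd hρ
  obtain ⟨ρ', hρ'⟩ := hd'.exists_isMonodromy hp
  have hA' : ∀ y ∈ {y | p y ∉ P.curve i}, ∀ᶠ z in 𝓝 y, A z = A y := hA
  have hconst : ∀ {e : PantsEnd ι J} {line : ℂ → X}, ContinuousOn line {z | 0 < z.im} →
      (∀ z : ℂ, 0 < z.im → p (line z) = P.endMap e z) →
      ∀ {z w : ℂ}, 0 < z.im → 0 < w.im → A (line z) = A (line w) := by
    intro e line hc hlift z w hz hw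
    refine eq_of_isPreconnected hA' isPreconnected_upperHalfPlane hc (fun z hz => ?_) hz hw
    rw [Set.mem_ofPred_eq, hlift z hz]
    exact P.endMap_notMem_curve e i hz
  have hleaf : ∀ {e e' : PantsEnd ι J} {leaf : ℝ → X}, P.Adjacent e e' → Continuous leaf →
      (∀ t, p (leaf t) = L.leaf e e' t) → ∀ s t, A (leaf s) = A (leaf t) := by
    intro e e' leaf hadj hc hlift s t
    refine eq_of_isPreconnected hA' isPreconnected_univ hc.continuousOn (fun t _ => ?_)
      (Set.mem_univ s) (Set.mem_univ t)
    rw [Set.mem_ofPred_eq, hlift t]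
    exact P.notMem_curve_of_mem_pantsRegion (L.leaf_mem e e' hadj t) i
  have hliftL : ∀ z : ℂ, 0 < z.im → p (d.line z) = P.endMap (.left i) z := fun z _ => d.line_lift z
  have hliftR : ∀ z : ℂ, 0 < z.im → p (d.line (-z)) = P.endMap (.right i) z :=
    fun z _ => d.line_lift (-z)
  -- The values of `A` immediately to the left and to the right of the lift of $C_i$.
  set a := A (d.line Complex.I)
  set b := A (d.line (-Complex.I))
  have hI : 0 < Complex.I.im := by simp
  have haline : ∀ z : ℂ, 0 < z.im → A (d.line z) = a := fun z hz =>
    hconst d.line_continuous.continuousOn hliftL hz hI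
  have hbline : ∀ z : ℂ, 0 < z.im → A (d.line (-z)) = b := fun z hz =>
    hconst (line := fun z => d.line (-z)) (d.line_continuous.comp continuous_neg).continuousOn
      hliftR hz hI
  -- The left leaf enters both half-plane neighborhoods, of the lift of $C_i$ and of the lift at its
  -- other end, and carries the value `a` from one to the other.
  have haL : ∀ z : ℂ, 0 < z.im → A (d.lineL z) = a := by
    intro z hz
    obtain ⟨ζ, -, hζ, -⟩ := d.leafL_asymptotic
    obtain ⟨ξ, -, hξ, -⟩ := d.lineL_asymptotic
    obtain ⟨s, hs0, hs⟩ := hζ.exists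
    obtain ⟨t, ht0, ht⟩ := hξ.exists
    rw [hconst d.lineL_continuousOn d.lineL_lift hz ht0, ← ht, ← haline _ hs0, ← hs]
    exact hleaf d.endL_adjacent d.leafL_continuous d.leafL_lift _ _
  have hbR : ∀ z : ℂ, 0 < z.im → A (d.lineR z) = b := by
    intro z hz
    obtain ⟨ζ, -, hζ, -⟩ := d.leafR_asymptotic
    obtain ⟨ξ, -, hξ, -⟩ := d.lineR_asymptotic
    obtain ⟨s, hs0, hs⟩ := hζ.exists
    have hs : d.leafR s = d.line (-ζ s) := hs
    obtain ⟨t, ht0, ht⟩ := hξ.exists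
    rw [hconst d.lineR_continuousOn d.lineR_lift hz ht0, ← ht, ← hbline _ hs0, ← hs]
    exact hleaf d.endR_adjacent d.leafR_continuous d.leafR_lift _ _
  have hgen := monodromy_eq_conj_of_end hp hd hρ hρ' hA hr hdev hliftL
    (fun z _ => d.line_equivariant z) haline
  have hgenL := monodromy_eq_conj_of_end hp hd hρ hρ' hA hr hdev d.lineL_lift
    d.lineL_equivariant haL
  have hgenR := monodromy_eq_conj_of_end hp hd hρ hρ' hA hr hdev d.lineR_lift
    d.lineR_equivariant hbR
  have hinv : ∀ {γ : Deck p} {c : SL3}, ρ' γ = c * ρ γ * c⁻¹ → ρ' γ⁻¹ = c * ρ γ⁻¹ * c⁻¹ := by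
    intro γ c h
    rw [map_inv, map_inv, h]
    group
  have hT : IsEigenDilation t (ρ d.gen) (a⁻¹ * b) :=
    hdil d.line d.gen d.line_continuous d.line_lift d.line_equivariant _ _ hI (by simp)
  refine ⟨π', dev', ρ', hπ', hd', hρ', E.map a, F.map a, G.map a, H.map b, ?_, ?_, ?_, ?_, ?_⟩
  · exact hinv hgen ▸ hE.map a
  · exact hgen ▸ hF.map a
  · exact hinv hgenL ▸ hG.map a
  · exact hinv hgenR ▸ hH.map b
  -- Factoring out `a` leaves $E,F,G$ fixed and moves $H$ by $a^{-1}b$, the eigen-dilation.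
  · have h := (hs.dilate ht hT (by rwa [← map_inv]) hF).map a
    rwa [Flag3.map_map, mul_inv_cancel_left] at h

end Deformation

end ConvexProjective

/-! ### Specialization to twists and bulges -/

theorem mainTheorem4 {S X : Type*} [TopologicalSpace S] [T2Space S] [CompactSpace S]
    [ConnectedSpace S] [ChartedSpace (EuclideanHalfSpace 2) S]
    [TopologicalSpace X] [SimplyConnectedSpace X] (p : X → S) (hp : IsCoveringMap p)
    (o : ConvexProjective.SurfaceOrientation S) {ι J : Type*} [Finite ι] [Finite J]
    (P : ConvexProjective.PantsDecomposition o ι J) (L : ConvexProjective.SpiralLamination P)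
    (i : ι) (d : ConvexProjective.ShearDatum p L i)
    (x : ConvexProjective.DeformationSpace p) (σ₁ σ₂ : ℝ)
    (hx : ConvexProjective.HasShearInvariants d x σ₁ σ₂) :
    (∀ (u : ℝ) (x' : ConvexProjective.DeformationSpace p), ConvexProjective.IsTwist P i u x x' →
      ∀ s₁ s₂ : ℝ, ConvexProjective.HasShearInvariants d x' s₁ s₂ ↔
        s₁ = σ₁ + u ∧ s₂ = σ₂ + u) ∧
    (∀ (v : ℝ) (x' : ConvexProjective.DeformationSpace p), ConvexProjective.IsBulge P i v x x' →
      ∀ s₁ s₂ : ℝ, ConvexProjective.HasShearInvariants d x' s₁ s₂ ↔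
        s₁ = σ₁ - 3 * v ∧ s₂ = σ₂ + 3 * v) := by
  have hiff : ∀ {x' : ConvexProjective.DeformationSpace p} {τ₁ τ₂ : ℝ},
      ConvexProjective.HasShearInvariants d x' τ₁ τ₂ → ∀ s₁ s₂ : ℝ,
        ConvexProjective.HasShearInvariants d x' s₁ s₂ ↔ s₁ = τ₁ ∧ s₂ = τ₂ := by
    intro x' τ₁ τ₂ h s₁ s₂
    refine ⟨fun h' => h.unique hp h', ?_⟩
    rintro ⟨rfl, rfl⟩
    exact h
  refine ⟨fun u x' hu => hiff ?_, fun v x' hv => hiff ?_⟩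
  -- For the twist, $t_2/t_1=t_1/t_0=e^{u}$.
  · have h := ConvexProjective.IsDeformationAlong.hasShearInvariants hp d
      (by intro j; fin_cases j <;> simp [Real.exp_pos]) hu hx
    convert h using 2
    · simp
    · simp [← Real.exp_neg]
  -- For the bulge, $t_2/t_1=e^{-3v}$ and $t_1/t_0=e^{3v}$.
  · have h := ConvexProjective.IsDeformationAlong.hasShearInvariants hp d
      (by intro j; fin_cases j <;> simp [Real.exp_pos]) hv hx
    convert h using 2
    · simp only [Matrix.cons_val, ← Real.exp_sub, Real.log_exp]
      ring
    · simp only [Matrix.cons_val, ← Real.exp_sub, Real.log_exp]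
      ring
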